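/- Let $\Gamma$ be a semigroup acting by continuous maps on a compact metric space $X$, and assume that the action is minimal, i.e. every orbit $\{f(x) : f\in\Gamma\}$ is dense in $X$. Let $A:\Gamma\times X\to \mathrm{GL}(n,\mathbb{R})$ be a linear cocycle above this action: $A(f,\cdot)$ is continuous for every $f\in\Gamma$, and $A(fg,x)=A(f,g(x))\,A(g,x)$ for all $f,g\in\Gamma$ and $x\in X$. Suppose that there exist a point $x_0\in X$ and a constant $C>0$ such that the quasiconformal distortion satisfies $$\|A(f,x_0)^{-1}\|\cdot\|A(f,x_0)\|\le C\qquad\text{for all } f\in\Gamma,$$ where $\|\cdot\|$ is the operator norm associated with the Euclidean norm on $\mathbb{R}^n$. Then there is a continuous invariant conformal structure on the bundle $X\times\mathbb{R}^n$, that is, a continuous map $\varphi$ from $X$ to the space of conformal structures on $\mathbb{R}^n$ (inner products up to multiplication by positive constants, with the quotient topology) such that the push-forward of $\varphi(x)$ by $A(f,x)$ is $\varphi(f(x))$ for all $f\in\Gamma$ and $x\in X$. Moreover, $A$ is continuously cohomologous to a cocycle with values in the group of conformal linear maps (nonzero multiples of linear isometries of Euclidean $\mathbb{R}^n$): there are a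 continuous map $B:X\to\mathrm{GL}(n,\mathbb{R})$ and a linear cocycle $\tilde A$ above the same action with $B(f(x))^{-1}A(f,x)B(x)=\tilde A(f,x)$ and $\tilde A(f,x)$ conformal for all $f\in\Gamma$ and $x\in X$. -/

import Mathlib

open Matrix

/-- A semigroup action on a topological space is minimal if every orbit is dense. -/
def IsMinimalAction (Γ X : Type*) [Semigroup Γ] [TopologicalSpace X] [SemigroupAction Γ X] : Prop :=
  ∀ x : X, Dense (Set.range fun f : Γ => f • x)

/-- A continuous linear cocycle with values in `GL(n, ℝ)` above an action of a semigroup `Γ`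
(without topology) on `X`. -/
structure IsLinearCocycle {Γ X : Type*} [Semigroup Γ] [TopologicalSpace X] [SemigroupAction Γ X]
    {n : ℕ} (A : Γ → X → GL (Fin n) ℝ) : Prop where
  continuous : ∀ f : Γ, Continuous (A f)
  map_mul : ∀ (f g : Γ) (x : X), A (f * g) x = A f (g • x) * A g x

/-- Two cocycles are (continuously) cohomologous if they are conjugate by a continuous map
`B : X → GL(n, ℝ)`. -/
def Cohomologous {Γ X : Type*} [Semigroup Γ] [TopologicalSpace X] [SemigroupAction Γ X]
    {n : ℕ} (A A' : Γ → X → GL (Fin n) ℝ) : Prop :=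
  ∃ B : X → GL (Fin n) ℝ, Continuous B ∧
    ∀ (f : Γ) (x : X), (B (f • x))⁻¹ * A f x * B x = A' f x

/-- The linear map of Euclidean space `ℝⁿ` given by an invertible matrix. -/
noncomputable def glToCLM {n : ℕ} (g : GL (Fin n) ℝ) :
    EuclideanSpace ℝ (Fin n) →L[ℝ] EuclideanSpace ℝ (Fin n) :=
  Matrix.toEuclideanCLM (n := Fin n) (𝕜 := ℝ) (g : Matrix (Fin n) (Fin n) ℝ)

/-- The quasiconformal distortion of an invertible matrix, with respect to the operator norm
coming from the Euclidean norm. -/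
noncomputable def qcDistortion {n : ℕ} (g : GL (Fin n) ℝ) : ℝ :=
  ‖glToCLM g⁻¹‖ * ‖glToCLM g‖

theorem glToCLM_one {n : ℕ} :
    glToCLM (1 : GL (Fin n) ℝ) = ContinuousLinearMap.id ℝ (EuclideanSpace ℝ (Fin n)) := by
  simp only [glToCLM, Units.val_one, map_one]
  rfl

theorem glToCLM_mul {n : ℕ} (g h : GL (Fin n) ℝ) :
    glToCLM (g * h) = (glToCLM g).comp (glToCLM h) := by
  simp only [glToCLM, Units.val_mul, map_mul]
  rfl

/-- The group of conformal linear maps of Euclidean `ℝⁿ` (nonzero multiples of isometries). -/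
noncomputable def conformalLinearGroup (n : ℕ) : Subgroup (GL (Fin n) ℝ) where
  carrier := {g | IsConformalMap (glToCLM g)}
  one_mem' := by
    simp only [Set.mem_ofPred_eq, glToCLM_one]
    exact isConformalMap_id
  mul_mem' := by
    intro g h hg hh
    simp only [Set.mem_ofPred_eq, glToCLM_mul] at *
    exact hg.comp hh
  inv_mem' := by
    rintro g ⟨c, hc, li, hli⟩
    have h1 : ∀ v, glToCLM g (glToCLM g⁻¹ v) = v := fun v => by
      rw [← ContinuousLinearMap.comp_apply, ← glToCLM_mul, mul_inv_cancel, glToCLM_one]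
      rfl
    refine ⟨c⁻¹, inv_ne_zero hc, ⟨(c • glToCLM g⁻¹ : _ →L[ℝ] _).toLinearMap, fun v => ?_⟩, ?_⟩
    · have h2 := h1 v
      rw [hli] at h2
      calc ‖c • glToCLM g⁻¹ v‖ = ‖c • li (glToCLM g⁻¹ v)‖ := by
            rw [norm_smul, norm_smul, li.norm_map]
        _ = ‖v‖ := congrArg norm h2
    · ext1 v
      change glToCLM g⁻¹ v = c⁻¹ • (c • glToCLM g⁻¹ v)
      rw [smul_smul, inv_mul_cancel₀ hc, one_smul]

/-- Inner products on `ℝⁿ`, represented by their Gram matrices `Q`: `⟨v, w⟩ = vᵀ Q w`. -/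
abbrev InnerProductMatrix (n : ℕ) : Type :=
  {Q : Matrix (Fin n) (Fin n) ℝ // Q.PosDef}

/-- Two inner products are conformally equivalent if they are positive multiples of each other. -/
def conformalSetoid (n : ℕ) : Setoid (InnerProductMatrix n) where
  r Q R := ∃ c : ℝ, 0 < c ∧ R.1 = c • Q.1
  iseqv :=
    { refl := fun Q => ⟨1, one_pos, (one_smul ℝ Q.1).symm⟩
      symm := by
        rintro Q R ⟨c, hc, h⟩
        exact ⟨c⁻¹, inv_pos.2 hc, by rw [h, smul_smul, inv_mul_cancel₀ hc.ne', one_smul]⟩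
      trans := by
        rintro Q R S ⟨c, hc, h⟩ ⟨d, hd, h'⟩
        exact ⟨d * c, mul_pos hd hc, by rw [h', h, smul_smul]⟩ }

/-- Conformal structures on `ℝⁿ`: inner products up to positive scaling. -/
def ConformalStructure (n : ℕ) : Type :=
  Quotient (conformalSetoid n)

/-- The space of conformal structures carries the quotient topology. -/
instance (n : ℕ) : TopologicalSpace (ConformalStructure n) :=
  inferInstanceAs (TopologicalSpace (Quotient (conformalSetoid n)))

/-- The push-forward of an inner product by `g`: `⟨v, w⟩ ↦ ⟨g⁻¹ v, g⁻¹ w⟩`. -/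
noncomputable def InnerProductMatrix.push {n : ℕ} (g : GL (Fin n) ℝ) (Q : InnerProductMatrix n) :
    InnerProductMatrix n :=
  ⟨((g⁻¹ : GL (Fin n) ℝ) : Matrix (Fin n) (Fin n) ℝ)ᵀ * Q.1 *
      ((g⁻¹ : GL (Fin n) ℝ) : Matrix (Fin n) (Fin n) ℝ), by
    have h := (Matrix.IsUnit.posDef_star_left_conjugate_iff (x := Q.1) (g⁻¹).isUnit).2 Q.2
    rwa [Matrix.star_eq_conjTranspose, Matrix.conjTranspose_eq_transpose_of_trivial] at h⟩

/-- The push-forward of a conformal structure by an invertible linear map. -/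
noncomputable def ConformalStructure.push {n : ℕ} (g : GL (Fin n) ℝ) :
    ConformalStructure n → ConformalStructure n :=
  Quotient.map (sa := conformalSetoid n) (sb := conformalSetoid n) (InnerProductMatrix.push g) (by
    rintro Q R ⟨c, hc, h⟩
    exact ⟨c, hc, by simp only [InnerProductMatrix.push, h, Matrix.mul_smul, Matrix.smul_mul]⟩)

/-- A field `x ↦ φ x` of conformal structures on the bundle `X × ℝⁿ` is a continuous invariant
conformal structure for the skew action `f : (x, v) ↦ (f x, A f x v)` if it is continuous and each
`A f x` carries the structure over `x` to the structure over `f x`. -/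
structure IsContinuousInvariantConformalStructure {Γ X : Type*} [Semigroup Γ] [TopologicalSpace X]
    [SemigroupAction Γ X] {n : ℕ} (A : Γ → X → GL (Fin n) ℝ) (φ : X → ConformalStructure n) :
    Prop where
  continuous : Continuous φ
  invariant : ∀ (f : Γ) (x : X), (φ x).push (A f x) = φ (f • x)

/-!
The space of inner products of determinant one on `ℝⁿ` is nonpositively curved, and the proof is
that of a fixed point theorem: a bounded orbit has a compact invariant closure, and the centres of the
smallest balls containing its fibres form an invariant section. Riemannian distances are avoided
by measuring how far an inner product `P` is from a dual inner product `S` (both positive definite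
of determinant one) by `tr (P S)`. This is invariant under `P ↦ gᵀ P g`, `S ↦ g⁻¹ S g⁻ᵀ`, it is
linear in `P`, and its sublevel sets are compact.

After scaling the cocycle to determinant `±1` (`detScale`), bounded distortion above `x₀` says that
the matrices `a f x₀` are bounded, so the closure `K` of the points `(f • x₀, a aᵀ)`, where
`a = a f x₀`, is compact; it is invariant, and by minimality every fibre of `K` is nonempty.
The least radius `t` such that the fibre over `x` lies in a "ball" `{S | tr (P S) ≤ t}` does not
depend on `x`: the set of `x` with radius below `t` is open (compactness of `K`) and backward
invariant (invariance of `K`), hence by minimality empty or everything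
(`ballCenters_nonempty_of_minRadius_lt`). Strict concavity of the determinant
(`Matrix.PosDef.one_lt_det_midpoint`) makes the centre `c x` of the smallest ball unique
(`ballCenters_minRadius_subsingleton`). Since `(a f x)ᵀ c (f • x) (a f x)` is the centre of a ball
of the same radius about the fibre over `x`, it equals `c x`. The same convexity argument, with the
radius known to be constant, shows that `c` is continuous
(`continuous_of_mem_ballCenters_minRadius`).

The class of `c` is the invariant conformal structure, and conjugation by the inverse of the
continuous field of square roots of `c` makes the cocycle conformal.
-/

/-! ### Positive semidefinite matrices -/

section PosSemidef

variable {ι : Type*} [Fintype ι]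

theorem Matrix.PosSemidef.transpose_mul_mul_same {P : Matrix ι ι ℝ} (hP : P.PosSemidef)
    (B : Matrix ι ι ℝ) : (Bᵀ * P * B).PosSemidef := by
  simpa [conjTranspose_eq_transpose_of_trivial] using hP.conjTranspose_mul_mul_same B

theorem isClosed_posSemidef : IsClosed {P : Matrix ι ι ℝ | P.PosSemidef} := by
  simp only [posSemidef_iff_dotProduct_mulVec, Set.ofPred_and, Set.ofPred_forall]
  refine IsClosed.inter (isClosed_eq (by fun_prop) continuous_id) (isClosed_iInter fun v => ?_)
  exact isClosed_le continuous_const (by fun_prop)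

variable [DecidableEq ι]

theorem Matrix.PosSemidef.exists_eq_transpose_mul_self {S : Matrix ι ι ℝ} (hS : S.PosSemidef) :
    ∃ B : Matrix ι ι ℝ, S = Bᵀ * B := by
  open scoped MatrixOrder in
  obtain ⟨B, hB⟩ := CStarAlgebra.nonneg_iff_eq_star_mul_self.mp hS.nonneg
  exact ⟨B, by rw [hB, star_eq_conjTranspose, conjTranspose_eq_transpose_of_trivial]⟩

theorem Matrix.PosSemidef.posDef_of_det_eq_one {P : Matrix ι ι ℝ} (hP : P.PosSemidef)
    (h : P.det = 1) : P.PosDef :=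
  hP.posDef_iff_det_ne_zero.2 (by simp [h])

theorem Matrix.PosSemidef.abs_apply_le_trace {P : Matrix ι ι ℝ} (hP : P.PosSemidef) (i j : ι) :
    |P i j| ≤ P.trace := by
  have hd : ∀ k, P k k ≤ P.trace := fun k =>
    Finset.single_le_sum (f := fun k => P k k) (fun k _ => hP.diag_nonneg) (Finset.mem_univ k)
  have hs : P j i = P i j := by simpa using hP.1.apply i j
  -- evaluate the form at `e i ± e j` and polarize
  have h1 := hP.dotProduct_mulVec_nonneg (Pi.single i 1 + Pi.single j 1)
  have h2 := hP.dotProduct_mulVec_nonneg (Pi.single i 1 - Pi.single j 1)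
  simp [mulVec_add, mulVec_sub, add_dotProduct, sub_dotProduct] at h1 h2
  have h3 := hd i
  have h4 := hd j
  rw [abs_le]
  constructor <;> linarith

theorem isCompact_of_posSemidef_of_trace_le {s : Set (Matrix ι ι ℝ)} (hs : IsClosed s)
    (hpos : ∀ P ∈ s, P.PosSemidef) {M : ℝ} (hM : ∀ P ∈ s, P.trace ≤ M) : IsCompact s := by
  have hbox : IsCompact (Set.univ.pi fun _ : ι => Set.univ.pi fun _ : ι => Set.Icc (-M) M) :=
    isCompact_univ_pi fun _ => isCompact_univ_pi fun _ => isCompact_Icc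
  refine hbox.of_isClosed_subset hs fun P hP i _ j _ => ?_
  exact abs_le.1 (((hpos P hP).abs_apply_le_trace i j).trans (hM P hP))

theorem Matrix.PosSemidef.trace_mul_nonneg {P S : Matrix ι ι ℝ} (hP : P.PosSemidef)
    (hS : S.PosSemidef) : 0 ≤ (P * S).trace := by
  obtain ⟨B, rfl⟩ := hS.exists_eq_transpose_mul_self
  rw [← mul_assoc, trace_mul_comm, ← mul_assoc]
  simpa using (hP.transpose_mul_mul_same Bᵀ).trace_nonneg

theorem Matrix.PosSemidef.trace_mul_pos {P S : Matrix ι ι ℝ} (hP : P.PosSemidef) (hP0 : P ≠ 0)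
    (hS : S.PosDef) : 0 < (P * S).trace := by
  refine (hP.trace_mul_nonneg hS.posSemidef).lt_of_ne fun h => hP0 ?_
  obtain ⟨B, rfl⟩ := hS.posSemidef.exists_eq_transpose_mul_self
  have hB : IsUnit B.det := by
    have := hS.det_pos.ne'
    rw [det_mul, det_transpose] at this
    exact isUnit_iff_ne_zero.2 (left_ne_zero_of_mul this)
  have hB' : IsUnit Bᵀ.det := by rwa [det_transpose]
  rw [← mul_assoc, trace_mul_comm, ← mul_assoc] at h
  have h0 : B * P * Bᵀ = 0 := by
    have := hP.transpose_mul_mul_same Bᵀ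
    rw [transpose_transpose] at this
    exact this.trace_eq_zero_iff.1 h.symm
  calc P = B⁻¹ * (B * P * Bᵀ) * Bᵀ⁻¹ := by
        rw [mul_assoc, mul_nonsing_inv_cancel_right _ _ hB', nonsing_inv_mul_cancel_left _ _ hB]
    _ = 0 := by rw [h0, mul_zero, zero_mul]

/-- On a compact set of inner products, `P ↦ tr (P S)` is uniformly comparable with `tr P`. -/
theorem exists_pos_mul_trace_le {s : Set (Matrix ι ι ℝ)} (hs : IsCompact s)
    (hpos : ∀ S ∈ s, S.PosDef) :
    ∃ m : ℝ, 0 < m ∧ ∀ S ∈ s, ∀ P : Matrix ι ι ℝ, P.PosSemidef → m * P.trace ≤ (P * S).trace := by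
  have hT : IsCompact {P : Matrix ι ι ℝ | P.PosSemidef ∧ P.trace = 1} :=
    isCompact_of_posSemidef_of_trace_le
      (isClosed_posSemidef.inter (isClosed_eq (by fun_prop) continuous_const))
      (fun P hP => hP.1) (fun P hP => hP.2.le)
  obtain ⟨m, hm, hle⟩ := (hT.prod hs).exists_forall_le' (a := 0)
    (f := fun q : Matrix ι ι ℝ × Matrix ι ι ℝ => (q.1 * q.2).trace) (by fun_prop) (by
      rintro ⟨P, S⟩ ⟨hP, hS⟩
      refine hP.1.trace_mul_pos (fun h => ?_) (hpos S hS)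
      have : P.trace = 1 := hP.2
      rw [show P = 0 from h, trace_zero] at this
      exact zero_ne_one this)
  refine ⟨m, hm, fun S hS P hP => ?_⟩
  rcases hP.trace_nonneg.eq_or_lt with h0 | h0
  · rw [← h0, hP.trace_eq_zero_iff.1 h0.symm]
    simp
  · have h1 := hle (P.trace⁻¹ • P, S) ⟨⟨hP.smul (inv_nonneg.2 h0.le), by
      simp [h0.ne']⟩, hS⟩
    simp only [smul_mul_assoc, trace_smul, smul_eq_mul] at h1
    rw [inv_mul_eq_div, le_div_iff₀ h0] at h1
    exact h1

/-- The special case of `Matrix.PosDef.one_lt_det_midpoint` in which one of the two inner products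
is the standard one. -/
theorem Matrix.PosDef.one_lt_det_half_one_add {T : Matrix ι ι ℝ} (hT : T.PosDef)
    (hdet : T.det = 1) (hne : T ≠ 1) : 1 < ((1 / 2 : ℝ) • (1 + T)).det := by
  set l := hT.1.eigenvalues with hl
  have hpos : ∀ i, 0 < l i := hT.eigenvalues_pos
  have hprod : ∏ i, l i = 1 := by
    have := hT.1.det_eq_prod_eigenvalues
    rw [hdet] at this
    simpa using this.symm
  have hspec := hT.1.spectral_theorem
  rw [Unitary.conjStarAlgAut_apply] at hspec
  set U : Matrix ι ι ℝ := (hT.1.eigenvectorUnitary : Matrix ι ι ℝ)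
  have hUU : U * star U = 1 := Unitary.coe_mul_star_self _
  have hdetU : U.det * (star U).det = 1 := by rw [← det_mul, hUU, det_one]
  have hlne : ∃ i, l i ≠ 1 := by
    by_contra! h
    apply hne
    have hd : diagonal (RCLike.ofReal ∘ l : ι → ℝ) = 1 := by
      rw [← diagonal_one]
      congr 1
      ext i
      simp [h i]
    rw [hspec, ← hl, hd, mul_one, hUU]
  have hfac : (1 / 2 : ℝ) • (1 + T) = U * diagonal (fun i => (1 + l i) / 2) * star U := by
    have hd : diagonal (fun i => (1 + l i) / 2)
        = (1 / 2 : ℝ) • (1 + diagonal (RCLike.ofReal ∘ l : ι → ℝ)) := by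
      rw [← diagonal_one, diagonal_add, ← diagonal_smul]
      congr 1
      ext i
      simp
      ring
    rw [hd, mul_smul_comm, smul_mul_assoc, mul_add, add_mul, mul_one, hUU, ← hspec]
  have hdet2 : ((1 / 2 : ℝ) • (1 + T)).det = ∏ i, (1 + l i) / 2 := by
    rw [hfac, det_mul, det_mul, det_diagonal, mul_right_comm, hdetU, one_mul]
  rw [hdet2]
  -- `((1 + l) / 2) ^ 2 ≥ l` with equality only at `l = 1`, and the eigenvalues have product one
  have hsq : 1 < (∏ i, (1 + l i) / 2) ^ 2 := by
    rw [← Finset.prod_pow, ← hprod]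
    obtain ⟨i, hi⟩ := hlne
    refine Finset.prod_lt_prod (fun i _ => hpos i) (fun i _ => ?_) ⟨i, Finset.mem_univ i, ?_⟩
    · nlinarith [sq_nonneg (l i - 1)]
    · nlinarith [sq_pos_of_ne_zero (sub_ne_zero.2 hi)]
  have h0 : 0 ≤ ∏ i, (1 + l i) / 2 :=
    Finset.prod_nonneg fun i _ => by linarith [hpos i]
  exact (one_lt_sq_iff₀ h0).1 hsq

/-- Strict concavity of the determinant: the midpoint of two distinct inner products of
determinant one has determinant larger than one. -/
theorem Matrix.PosDef.one_lt_det_midpoint {P Q : Matrix ι ι ℝ} (hP : P.PosDef) (hQ : Q.PosDef)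
    (hP1 : P.det = 1) (hQ1 : Q.det = 1) (hne : P ≠ Q) : 1 < ((1 / 2 : ℝ) • (P + Q)).det := by
  -- the change of basis `B` reduces to the case `P = 1`
  obtain ⟨B, rfl⟩ := hP.posSemidef.exists_eq_transpose_mul_self
  have hBB : B.det * B.det = 1 := by simpa using hP1
  have hB : IsUnit B.det := IsUnit.of_mul_eq_one _ hBB
  have hB' : IsUnit Bᵀ.det := by rwa [det_transpose]
  set T := (B⁻¹)ᵀ * Q * B⁻¹ with hTdef
  have hQT : Q = Bᵀ * T * B := by
    rw [hTdef, transpose_nonsing_inv, mul_assoc, nonsing_inv_mul_cancel_right _ _ hB,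
      mul_nonsing_inv_cancel_left _ _ hB']
  have hT1 : T.det = 1 := by
    have : Bᵀ.det * T.det * B.det = 1 := by rw [← det_mul, ← det_mul, ← hQT, hQ1]
    rwa [det_transpose, mul_right_comm, hBB, one_mul] at this
  have hT : T.PosDef := (hQ.posSemidef.transpose_mul_mul_same B⁻¹).posDef_of_det_eq_one hT1
  have hTne : T ≠ 1 := fun h => hne (by rw [hQT, h, mul_one])
  have hfac : (1 / 2 : ℝ) • (Bᵀ * B + Q) = Bᵀ * ((1 / 2 : ℝ) • (1 + T)) * B := by
    rw [hQT, mul_smul_comm, smul_mul_assoc, mul_add, add_mul, mul_one]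
  rw [hfac, det_mul, det_mul, det_transpose, mul_right_comm, hBB, one_mul]
  exact hT.one_lt_det_half_one_add hT1 hTne

end PosSemidef

/-! ### The invariant section of a bounded invariant family of inner products -/

section Center

variable {X ι : Type*} [Fintype ι]

/-- Upper semicontinuity of the fibres of a compact set. -/
theorem isOpen_setOf_forall_trace_lt [TopologicalSpace X] [T2Space X]
    {K : Set (X × Matrix ι ι ℝ)} (hK : IsCompact K) (P : Matrix ι ι ℝ) (t : ℝ) :
    IsOpen {x : X | ∀ S, (x, S) ∈ K → (P * S).trace < t} := by
  have hc : IsClosed (Prod.fst '' (K ∩ {q : X × Matrix ι ι ℝ | t ≤ (P * q.2).trace})) :=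
    ((hK.inter_right (isClosed_le continuous_const (by fun_prop))).image continuous_fst).isClosed
  convert hc.isOpen_compl using 1
  ext x
  simp only [Set.mem_ofPred_eq, Set.mem_compl_iff, Set.mem_image, Set.mem_inter_iff, Prod.exists,
    exists_and_right, exists_eq_right, not_exists, not_and, not_le]

variable [DecidableEq ι]

/-- For a family `K ⊆ X × Mat` of dual inner products (the fibre over `x` being
`{S | (x, S) ∈ K}`), the set of inner products `P` of determinant one whose "distance"
`tr (P S)` to each member `S` of the fibre over `x` is at most `t`: the centres of the balls of
radius `t` that contain the fibre. -/
def ballCenters (K : Set (X × Matrix ι ι ℝ)) (x : X) (t : ℝ) : Set (Matrix ι ι ℝ) :=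
  {P | P.PosSemidef ∧ P.det = 1 ∧ ∀ S, (x, S) ∈ K → (P * S).trace ≤ t}

/-- The smallest radius of a ball containing a fibre of `K`, the infimum being taken over all
base points at once. For a compact invariant family above a minimal action it is attained at every
base point (`ballCenters_minRadius_nonempty`). -/
noncomputable def minRadius (K : Set (X × Matrix ι ι ℝ)) : ℝ :=
  sInf {t | ∃ x, (ballCenters K x t).Nonempty}

theorem ballCenters_mono (K : Set (X × Matrix ι ι ℝ)) (x : X) {s t : ℝ} (h : s ≤ t) :
    ballCenters K x s ⊆ ballCenters K x t :=
  fun _ hP => ⟨hP.1, hP.2.1, fun S hS => (hP.2.2 S hS).trans h⟩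

theorem ballCenters.posDef {K : Set (X × Matrix ι ι ℝ)} {x : X} {t : ℝ} {P : Matrix ι ι ℝ}
    (hP : P ∈ ballCenters K x t) : P.PosDef :=
  hP.1.posDef_of_det_eq_one hP.2.1

theorem isClosed_ballCenters (K : Set (X × Matrix ι ι ℝ)) (x : X) (t : ℝ) :
    IsClosed (ballCenters K x t) := by
  have : ballCenters K x t = {P | P.PosSemidef} ∩ ({P | P.det = 1} ∩
      ⋂ S : Matrix ι ι ℝ, ⋂ _ : (x, S) ∈ K, {P | (P * S).trace ≤ t}) := by
    ext P
    simp [ballCenters]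
  rw [this]
  exact isClosed_posSemidef.inter ((isClosed_eq (by fun_prop) continuous_const).inter
    (isClosed_iInter fun S => isClosed_iInter fun _ => isClosed_le (by fun_prop) continuous_const))

variable {K : Set (X × Matrix ι ι ℝ)}

theorem minRadius_le (hpos : ∀ q ∈ K, q.2.PosDef) (hfib : ∀ x : X, ∃ S, (x, S) ∈ K)
    {x : X} {t : ℝ} (h : (ballCenters K x t).Nonempty) : minRadius K ≤ t := by
  refine csInf_le ⟨0, ?_⟩ ⟨x, h⟩
  rintro s ⟨y, P, hP⟩
  obtain ⟨S, hS⟩ := hfib y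
  exact (hP.1.trace_mul_nonneg (hpos _ hS).posSemidef).trans (hP.2.2 S hS)

/-- Homogeneity of `P ↦ tr (P S)` turns the minimality of the radius among inner products of
determinant one into a bound for all inner products. -/
theorem minRadius_mul_det_rpow_le [Nonempty ι] (hpos : ∀ q ∈ K, q.2.PosDef)
    (hfib : ∀ x : X, ∃ S, (x, S) ∈ K) {x : X} {t : ℝ} {P : Matrix ι ι ℝ} (hP : P.PosDef)
    (h : ∀ S, (x, S) ∈ K → (P * S).trace ≤ t) :
    minRadius K * P.det ^ (1 / Fintype.card ι : ℝ) ≤ t := by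
  set d : ℝ := P.det ^ (1 / Fintype.card ι : ℝ) with hd
  have hd0 : 0 < d := Real.rpow_pos_of_pos hP.det_pos _
  have hcard : (Fintype.card ι : ℝ) ≠ 0 := by simp
  have hdn : d ^ Fintype.card ι = P.det := by
    rw [hd, ← Real.rpow_natCast, ← Real.rpow_mul hP.det_pos.le, one_div, inv_mul_cancel₀ hcard,
      Real.rpow_one]
  rw [← le_div_iff₀ hd0]
  refine minRadius_le hpos hfib (x := x)
    ⟨d⁻¹ • P, hP.posSemidef.smul (inv_nonneg.2 hd0.le), ?_, fun S hS => ?_⟩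
  · rw [det_smul, inv_pow, hdn, inv_mul_cancel₀ hP.det_pos.ne']
  · rw [smul_mul_assoc, trace_smul, smul_eq_mul, inv_mul_eq_div]
    exact div_le_div_of_nonneg_right (h S hS) hd0.le

theorem minRadius_pos [Nonempty ι] (hpos : ∀ q ∈ K, q.2.PosDef)
    (hfib : ∀ x : X, ∃ S, (x, S) ∈ K) {x : X}
    (h : (ballCenters K x (minRadius K)).Nonempty) : 0 < minRadius K := by
  obtain ⟨P, hP⟩ := h
  obtain ⟨S, hS⟩ := hfib x
  refine (hP.1.trace_mul_pos (fun h0 => ?_) (hpos _ hS)).trans_le (hP.2.2 S hS)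
  have h1 := hP.2.1
  rw [h0, det_zero] at h1
  exact zero_ne_one h1

/-- The ball of minimal radius containing a fibre is unique: the midpoint of two centres,
rescaled to determinant one, would be the centre of a smaller ball. -/
theorem ballCenters_minRadius_subsingleton [Nonempty ι] (hpos : ∀ q ∈ K, q.2.PosDef)
    (hfib : ∀ x : X, ∃ S, (x, S) ∈ K) (x : X) :
    (ballCenters K x (minRadius K)).Subsingleton := by
  intro P hP Q hQ
  by_contra hne
  have hr := minRadius_pos hpos hfib ⟨P, hP⟩
  have hPd := ballCenters.posDef hP
  have hQd := ballCenters.posDef hQ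
  have h1 := hPd.one_lt_det_midpoint hQd hP.2.1 hQ.2.1 hne
  have h2 := minRadius_mul_det_rpow_le hpos hfib (x := x) (t := minRadius K)
    ((hPd.add hQd).smul (one_half_pos (α := ℝ))) fun S hS => by
      rw [smul_mul_assoc, trace_smul, add_mul, trace_add, smul_eq_mul]
      linarith [hP.2.2 S hS, hQ.2.2 S hS]
  have h3 := Real.one_lt_rpow h1 (z := 1 / (Fintype.card ι : ℝ)) (by positivity)
  nlinarith

variable {Γ : Type*} [Semigroup Γ] [SemigroupAction Γ X] {a : Γ → X → Matrix ι ι ℝ}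

theorem transpose_mul_mul_mem_ballCenters (hdet : ∀ f x, (a f x).det ^ 2 = 1)
    (hinv : ∀ (f : Γ) (x : X) S, (x, S) ∈ K → (f • x, a f x * S * (a f x)ᵀ) ∈ K)
    {f : Γ} {x : X} {t : ℝ} {P : Matrix ι ι ℝ} (hP : P ∈ ballCenters K (f • x) t) :
    (a f x)ᵀ * P * a f x ∈ ballCenters K x t := by
  refine ⟨hP.1.transpose_mul_mul_same _, ?_, fun S hS => ?_⟩
  · rw [det_mul, det_mul, det_transpose, hP.2.1, mul_one, ← sq, hdet]
  · refine le_of_eq_of_le ?_ (hP.2.2 _ (hinv f x S hS))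
    rw [mul_assoc, mul_assoc, trace_mul_comm, mul_assoc, mul_assoc]

variable [TopologicalSpace X]

/-- All the balls of a given radius about the fibres have their centres in one compact set. -/
theorem exists_isCompact_ballCenters_subset (hK : IsCompact K) (hpos : ∀ q ∈ K, q.2.PosDef)
    (hfib : ∀ x : X, ∃ S, (x, S) ∈ K) (t : ℝ) :
    ∃ s : Set (Matrix ι ι ℝ), IsCompact s ∧ (∀ P ∈ s, P.PosSemidef ∧ P.det = 1) ∧
      ∀ x : X, ballCenters K x t ⊆ s := by
  obtain ⟨m, hm, hle⟩ := exists_pos_mul_trace_le (hK.image continuous_snd) (by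
    rintro _ ⟨q, hq, rfl⟩
    exact hpos q hq)
  refine ⟨{P | P.PosSemidef} ∩ ({P | P.det = 1} ∩ {P | P.trace ≤ t / m}),
    isCompact_of_posSemidef_of_trace_le (isClosed_posSemidef.inter
      ((isClosed_eq (by fun_prop) continuous_const).inter
        (isClosed_le (by fun_prop) continuous_const))) (fun P hP => hP.1) (fun P hP => hP.2.2),
    fun P hP => ⟨hP.1, hP.2.1⟩, fun x P hP => ⟨hP.1, hP.2.1, ?_⟩⟩
  obtain ⟨S, hS⟩ := hfib x
  rw [Set.mem_ofPred_eq, le_div_iff₀ hm, mul_comm]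
  exact (hle S ⟨(x, S), hS, rfl⟩ P hP.1).trans (hP.2.2 S hS)

/-- By minimality, every fibre is contained in a ball of radius `t`, for each `t` larger than the
radius of a ball containing some fibre: the set of base points whose fibres have this property is
open and backward invariant. -/
theorem ballCenters_nonempty_of_minRadius_lt [T2Space X] (hmin : IsMinimalAction Γ X)
    (hK : IsCompact K) (hdet : ∀ f x, (a f x).det ^ 2 = 1)
    (hinv : ∀ (f : Γ) (x : X) S, (x, S) ∈ K → (f • x, a f x * S * (a f x)ᵀ) ∈ K)
    [Nonempty X] {t : ℝ} (ht : minRadius K < t) (x : X) : (ballCenters K x t).Nonempty := by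
  have hne : {t | ∃ x, (ballCenters K x t).Nonempty}.Nonempty := by
    obtain ⟨x₀⟩ := ‹Nonempty X›
    obtain ⟨M, hM⟩ := (hK.image (f := fun q : X × Matrix ι ι ℝ => q.2.trace)
      (by fun_prop)).bddAbove
    exact ⟨M, x₀, 1, PosSemidef.one, det_one, fun S hS =>
      by rw [one_mul]; exact hM ⟨(x₀, S), hS, rfl⟩⟩
  obtain ⟨s, ⟨y, P, hP⟩, hst⟩ := exists_lt_of_csInf_lt hne ht
  obtain ⟨_, hz, f, rfl⟩ := (hmin x).inter_open_nonempty _ (isOpen_setOf_forall_trace_lt hK P t)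
    ⟨y, fun S hS => (hP.2.2 S hS).trans_lt hst⟩
  exact ⟨_, transpose_mul_mul_mem_ballCenters hdet hinv
    (show P ∈ ballCenters K (f • x) t from ⟨hP.1, hP.2.1, fun S hS => (hz S hS).le⟩)⟩

theorem ballCenters_minRadius_nonempty [T2Space X] (hmin : IsMinimalAction Γ X)
    (hK : IsCompact K) (hpos : ∀ q ∈ K, q.2.PosDef) (hfib : ∀ x : X, ∃ S, (x, S) ∈ K)
    (hdet : ∀ f x, (a f x).det ^ 2 = 1)
    (hinv : ∀ (f : Γ) (x : X) S, (x, S) ∈ K → (f • x, a f x * S * (a f x)ᵀ) ∈ K)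
    [Nonempty X] (x : X) : (ballCenters K x (minRadius K)).Nonempty := by
  set u : ℕ → ℝ := fun k => minRadius K + 1 / (k + 1) with hu
  have hlim : Filter.Tendsto u Filter.atTop (nhds (minRadius K)) := by
    simpa [hu] using tendsto_one_div_add_atTop_nhds_zero_nat.const_add (minRadius K)
  have hcl := fun k => isClosed_ballCenters K x (u k)
  obtain ⟨s, hs, -, hsub⟩ := exists_isCompact_ballCenters_subset hK hpos hfib (u 0)
  obtain ⟨P, hP⟩ := IsCompact.nonempty_iInter_of_sequence_nonempty_isCompact_isClosed
    (fun k => ballCenters K x (u k))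
    (fun k => ballCenters_mono K x (by
      simp only [hu]
      gcongr
      simp))
    (fun k => ballCenters_nonempty_of_minRadius_lt hmin hK hdet hinv
      (lt_add_of_pos_right _ (by positivity)) x)
    (hs.of_isClosed_subset (hcl 0) (hsub x)) hcl
  rw [Set.mem_iInter] at hP
  exact ⟨P, (hP 0).1, (hP 0).2.1, fun S hS =>
    ge_of_tendsto' hlim fun k => (hP k).2.2 S hS⟩

/-- The centre of the minimal ball containing the fibre depends continuously on the base point.
The fibres are only upper semicontinuous; the constancy of the minimal radius makes up for it. -/
theorem continuous_of_mem_ballCenters_minRadius [T2Space X] [Nonempty ι] (hK : IsCompact K)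
    (hpos : ∀ q ∈ K, q.2.PosDef) (hfib : ∀ x : X, ∃ S, (x, S) ∈ K) {c : X → Matrix ι ι ℝ}
    (hc : ∀ x, c x ∈ ballCenters K x (minRadius K)) : Continuous c := by
  rw [continuous_iff_continuousAt]
  intro x
  obtain ⟨s, hs, hs1, hsub⟩ := exists_isCompact_ballCenters_subset hK hpos hfib (minRadius K)
  refine hs.tendsto_nhds_of_unique_mapClusterPt (.of_forall fun y => hsub y (hc y))
    fun R hR hcl => ?_
  by_contra hne
  have hr := minRadius_pos hpos hfib ⟨_, hc x⟩
  have hcd := fun y => ballCenters.posDef (hc y)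
  set e : ℝ := 1 / (Fintype.card ι : ℝ) with he
  have he0 : 0 < e := by positivity
  have hdet := ((hs1 R hR).1.posDef_of_det_eq_one (hs1 R hR).2).one_lt_det_midpoint (hcd x)
    (hs1 R hR).2 (hc x).2.1 hne
  obtain ⟨q, hq1, hq⟩ := exists_between (Real.one_lt_rpow hdet he0)
  have hcont : Continuous fun P : Matrix ι ι ℝ => ((1 / 2 : ℝ) • (P + c x)).det ^ e :=
    Continuous.rpow_const (by fun_prop) fun _ => Or.inr he0.le
  have hfreq : ∃ᶠ y in nhds x, q < ((1 / 2 : ℝ) • (c y + c x)).det ^ e :=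
    hcl.frequently (hcont.continuousAt.eventually (lt_mem_nhds hq))
  -- the bound `r (2q - 1)`, where `r` is the minimal radius, is chosen so that its mean with `r`
  -- is `r q`; it exceeds `r` because `q > 1`
  have hev : ∀ᶠ y in nhds x, ∀ S, (y, S) ∈ K → (c x * S).trace < minRadius K * (2 * q - 1) :=
    (isOpen_setOf_forall_trace_lt hK (c x) _).mem_nhds fun S hS =>
      ((hc x).2.2 S hS).trans_lt (by nlinarith)
  obtain ⟨y, hy1, hy2⟩ := (hfreq.and_eventually hev).exists
  have h2 := minRadius_mul_det_rpow_le hpos hfib (x := y) (t := minRadius K * q)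
    (((hcd y).add (hcd x)).smul (one_half_pos (α := ℝ))) fun S hS => by
      rw [smul_mul_assoc, trace_smul, add_mul, trace_add, smul_eq_mul]
      linarith [(hc y).2.2 S hS, hy2 S hS]
  exact absurd (le_of_mul_le_mul_left h2 hr) hy1.not_ge

/-- A compact family of dual inner products that is invariant under a cocycle of determinant
`±1` above a minimal action, has a continuous invariant field of inner products: the centres of
the minimal balls containing the fibres. -/
theorem exists_continuous_invariant_posDef [T2Space X] [Nonempty X] [Nonempty ι]
    (hmin : IsMinimalAction Γ X) (hK : IsCompact K) (hpos : ∀ q ∈ K, q.2.PosDef)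
    (hfib : ∀ x : X, ∃ S, (x, S) ∈ K) (hdet : ∀ f x, (a f x).det ^ 2 = 1)
    (hinv : ∀ (f : Γ) (x : X) S, (x, S) ∈ K → (f • x, a f x * S * (a f x)ᵀ) ∈ K) :
    ∃ c : X → Matrix ι ι ℝ, Continuous c ∧ (∀ x, (c x).PosDef) ∧
      ∀ f x, (a f x)ᵀ * c (f • x) * a f x = c x := by
  choose c hc using ballCenters_minRadius_nonempty hmin hK hpos hfib hdet hinv
  exact ⟨c, continuous_of_mem_ballCenters_minRadius hK hpos hfib hc,
    fun x => ballCenters.posDef (hc x), fun f x =>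
      ballCenters_minRadius_subsingleton hpos hfib x
        (transpose_mul_mul_mem_ballCenters hdet hinv (hc (f • x))) (hc x)⟩

/-- A cocycle of determinant `±1` above a minimal action whose values above one orbit are bounded
has a continuous invariant field of inner products. -/
theorem exists_continuous_invariant_posDef_of_bounded [CompactSpace X] [T2Space X] [Nonempty ι]
    [ContinuousConstSMul Γ X] (hmin : IsMinimalAction Γ X) (hcont : ∀ f : Γ, Continuous (a f))
    (hmul : ∀ (f g : Γ) x, a (f * g) x = a f (g • x) * a g x)
    (hdet : ∀ f x, (a f x).det ^ 2 = 1) {x₀ : X} {M : ℝ} (hM : ∀ f i j, |a f x₀ i j| ≤ M) :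
    ∃ c : X → Matrix ι ι ℝ, Continuous c ∧ (∀ x, (c x).PosDef) ∧
      ∀ f x, (a f x)ᵀ * c (f • x) * a f x = c x := by
  have : Nonempty X := ⟨x₀⟩
  -- the orbit of `(x₀, 1)` in the bundle of dual inner products, on which `a` acts by
  -- `S ↦ a S aᵀ`
  set G : Set (X × Matrix ι ι ℝ) := Set.range fun f : Γ => (f • x₀, a f x₀ * (a f x₀)ᵀ) with hG
  set s : Set (Matrix ι ι ℝ) := {S | S.PosSemidef} ∩ ({S | S.det = 1} ∩
    {S | S.trace ≤ ∑ _i : ι, ∑ _j : ι, M ^ 2}) with hs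
  have hscl : IsClosed s := isClosed_posSemidef.inter
    ((isClosed_eq (by fun_prop) continuous_const).inter
      (isClosed_le (by fun_prop) continuous_const))
  have hsc : IsCompact s :=
    isCompact_of_posSemidef_of_trace_le hscl (fun S hS => hS.1) fun S hS => hS.2.2
  have hGs : G ⊆ Set.univ ×ˢ s := by
    rintro _ ⟨f, rfl⟩
    refine ⟨trivial, ?_, ?_, ?_⟩
    · simpa using PosSemidef.one.transpose_mul_mul_same (a f x₀)ᵀ
    · change (a f x₀ * (a f x₀)ᵀ).det = 1
      rw [det_mul, det_transpose, ← sq, hdet]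
    · change ∑ i, ∑ j, a f x₀ i j * a f x₀ i j ≤ _
      gcongr with i _ j _
      rw [← sq, ← sq_abs]
      gcongr
      exact hM f i j
  have hKs : closure G ⊆ Set.univ ×ˢ s := closure_minimal hGs (isClosed_univ.prod hscl)
  have hK : IsCompact (closure G) :=
    (isCompact_univ.prod hsc).of_isClosed_subset isClosed_closure hKs
  refine exists_continuous_invariant_posDef hmin hK
    (fun q hq => (hKs hq).2.1.posDef_of_det_eq_one (hKs hq).2.2.1) (fun x => ?_) hdet
    fun f x S hS => ?_
  · have hcl : IsClosed (Prod.fst '' closure G) := (hK.image continuous_fst).isClosed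
    have hsub : (Set.range fun f : Γ => f • x₀) ⊆ Prod.fst '' closure G := by
      rintro _ ⟨f, rfl⟩
      exact ⟨_, subset_closure ⟨f, rfl⟩, rfl⟩
    obtain ⟨q, hq, rfl⟩ := closure_minimal hsub hcl (hmin x₀ x)
    exact ⟨q.2, hq⟩
  · have hc := hcont f
    have hF : Continuous fun q : X × Matrix ι ι ℝ => (f • q.1, a f q.1 * q.2 * (a f q.1)ᵀ) := by
      fun_prop
    have hmaps : Set.MapsTo (fun q : X × Matrix ι ι ℝ => (f • q.1, a f q.1 * q.2 * (a f q.1)ᵀ))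
        G G := by
      rintro _ ⟨g, rfl⟩
      exact ⟨f * g, by simp only [mul_smul, hmul, transpose_mul, mul_assoc]⟩
    exact hmaps.closure hF hS

end Center

/-! ### Square roots of continuous fields of inner products -/

/-- The positive square root depends continuously on the inner product: squaring is a continuous
injection on a compact set of positive semidefinite matrices, hence an embedding. -/
theorem exists_continuous_sqrt {X ι : Type*} [TopologicalSpace X] [CompactSpace X] [Fintype ι]
    [DecidableEq ι] {c : X → Matrix ι ι ℝ} (hc : Continuous c) (hpos : ∀ x, (c x).PosDef) :
    ∃ R : X → Matrix ι ι ℝ, Continuous R ∧ (∀ x, (R x)ᵀ = R x) ∧ (∀ x, R x * R x = c x) ∧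
      ∀ x, IsUnit (R x).det := by
  obtain ⟨M, hM⟩ := (isCompact_range (f := fun x => (c x).trace) (by fun_prop)).bddAbove
  set s : Set (Matrix ι ι ℝ) := {P | P.PosSemidef} ∩ {P | P.trace ≤ (M + Fintype.card ι) / 2}
  have hs : IsCompact s := isCompact_of_posSemidef_of_trace_le
    (isClosed_posSemidef.inter (isClosed_le (by fun_prop) continuous_const))
    (fun P hP => hP.1) fun P hP => hP.2
  have hroot : ∀ x, ∃ R : s, (R : Matrix ι ι ℝ) * R = c x := fun x => by
    open scoped MatrixOrder in
    have h1 : CFC.sqrt (c x) * CFC.sqrt (c x) = c x :=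
      CFC.sqrt_mul_sqrt_self (c x) (hpos x).posSemidef.nonneg
    have h2 : (CFC.sqrt (c x)).PosSemidef := (CFC.sqrt_nonneg (c x)).posSemidef
    refine ⟨⟨CFC.sqrt (c x), h2, ?_⟩, h1⟩
    have hT : (CFC.sqrt (c x))ᵀ = CFC.sqrt (c x) := by
      simpa [conjTranspose_eq_transpose_of_trivial] using h2.1.eq
    -- expand `0 ≤ tr ((R - 1)²)`
    have h3 := (PosSemidef.one.transpose_mul_mul_same (CFC.sqrt (c x) - 1)).trace_nonneg
    simp only [transpose_sub, transpose_one, hT, mul_one, sub_mul, mul_sub, one_mul, h1, trace_sub,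
      trace_one] at h3
    have h4 := hM ⟨x, rfl⟩
    simp only at h4
    rw [Set.mem_ofPred_eq]
    linarith
  choose R hR using hroot
  have : CompactSpace s := isCompact_iff_compactSpace.1 hs
  have hemb : Topology.IsClosedEmbedding fun P : s => (P : Matrix ι ι ℝ) * P := by
    refine Continuous.isClosedEmbedding (by fun_prop) fun P Q hPQ => Subtype.ext ?_
    open scoped MatrixOrder in
    have hP : (P : Matrix ι ι ℝ).PosSemidef := P.2.1
    have hQ : (Q : Matrix ι ι ℝ).PosSemidef := Q.2.1
    rw [← CFC.sqrt_mul_self (P : Matrix ι ι ℝ) hP.nonneg,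
      ← CFC.sqrt_mul_self (Q : Matrix ι ι ℝ) hQ.nonneg]
    exact congrArg CFC.sqrt hPQ
  refine ⟨fun x => R x, ?_, fun x => ?_, hR, fun x => ?_⟩
  · refine continuous_subtype_val.comp (hemb.isEmbedding.continuous_iff.2 ?_)
    simpa only [Function.comp_def, hR] using hc
  · simpa [conjTranspose_eq_transpose_of_trivial] using (R x).2.1.1.eq
  · have h := (hpos x).det_pos.ne'
    rw [← hR x, det_mul] at h
    exact isUnit_iff_ne_zero.2 (left_ne_zero_of_mul h)

/-! ### Normalization of the determinant and conformal linear maps -/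

section GeneralLinear

variable {n : ℕ}

theorem abs_apply_le_norm_glToCLM (g : GL (Fin n) ℝ) (i j : Fin n) :
    |(g : Matrix (Fin n) (Fin n) ℝ) i j| ≤ ‖glToCLM g‖ := by
  have h1 := (glToCLM g).le_opNorm (EuclideanSpace.single j 1)
  have h2 := PiLp.norm_apply_le (glToCLM g (EuclideanSpace.single j 1)) i
  have h3 : glToCLM g (EuclideanSpace.single j 1) i = (g : Matrix (Fin n) (Fin n) ℝ) i j := by
    simp [glToCLM]
  rw [h3] at h2
  simpa using h2.trans h1

/-- The factor that scales `g` to determinant `±1`. For `n = 0` it is `1`, since then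
`det g = 1`. -/
noncomputable def detScale (g : GL (Fin n) ℝ) : ℝ :=
  |(g : Matrix (Fin n) (Fin n) ℝ).det| ^ (-(1 / n) : ℝ)

theorem abs_det_pos (g : GL (Fin n) ℝ) : 0 < |(g : Matrix (Fin n) (Fin n) ℝ).det| :=
  abs_pos.2 ((isUnit_iff_isUnit_det _).1 g.isUnit).ne_zero

theorem detScale_pos (g : GL (Fin n) ℝ) : 0 < detScale g :=
  Real.rpow_pos_of_pos (abs_det_pos g) _

theorem detScale_mul (g h : GL (Fin n) ℝ) : detScale (g * h) = detScale g * detScale h := by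
  simp only [detScale, Units.val_mul, det_mul, abs_mul]
  exact Real.mul_rpow (abs_nonneg _) (abs_nonneg _)

theorem continuous_detScale : Continuous (detScale (n := n)) := by
  have : Continuous fun g : GL (Fin n) ℝ => |(g : Matrix (Fin n) (Fin n) ℝ).det| :=
    (Units.continuous_val.matrix_det).abs
  exact this.rpow_const fun g => Or.inl (abs_det_pos g).ne'

theorem det_detScale_smul_sq [NeZero n] (g : GL (Fin n) ℝ) :
    (detScale g • (g : Matrix (Fin n) (Fin n) ℝ)).det ^ 2 = 1 := by
  have hn : (n : ℝ) ≠ 0 := Nat.cast_ne_zero.2 (NeZero.ne n)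
  have h : detScale g ^ n = |(g : Matrix (Fin n) (Fin n) ℝ).det|⁻¹ := by
    rw [detScale, ← Real.rpow_natCast, ← Real.rpow_mul (abs_nonneg _), neg_mul, one_div,
      inv_mul_cancel₀ hn, Real.rpow_neg_one]
  rw [det_smul, Fintype.card_fin, h, ← sq_abs, abs_mul, abs_inv, abs_abs,
    inv_mul_cancel₀ (abs_det_pos g).ne', one_pow]

/-- Bounded distortion means that the matrix normalized to determinant `±1` is bounded:
`detScale g = |det g⁻¹| ^ (1 / n)` is at most a constant times `‖g⁻¹‖`. -/
theorem abs_detScale_smul_apply_le [NeZero n] (g : GL (Fin n) ℝ) (i j : Fin n) :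
    |(detScale g • (g : Matrix (Fin n) (Fin n) ℝ)) i j|
      ≤ (n.factorial : ℝ) ^ (1 / n : ℝ) * qcDistortion g := by
  have hn : (n : ℝ) ≠ 0 := Nat.cast_ne_zero.2 (NeZero.ne n)
  have hdet : |((g⁻¹ : GL (Fin n) ℝ) : Matrix (Fin n) (Fin n) ℝ).det|
      ≤ n.factorial * ‖glToCLM g⁻¹‖ ^ n := by
    have := det_le (abv := AbsoluteValue.abs) (abs_apply_le_norm_glToCLM g⁻¹)
    simpa using this
  have hinv : |((g⁻¹ : GL (Fin n) ℝ) : Matrix (Fin n) (Fin n) ℝ).det|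
      = |(g : Matrix (Fin n) (Fin n) ℝ).det|⁻¹ := by
    rw [coe_units_inv, det_nonsing_inv, Ring.inverse_eq_inv', abs_inv]
  have hscale : detScale g ≤ (n.factorial : ℝ) ^ (1 / n : ℝ) * ‖glToCLM g⁻¹‖ := by
    calc detScale g = |((g⁻¹ : GL (Fin n) ℝ) : Matrix (Fin n) (Fin n) ℝ).det| ^ (1 / n : ℝ) := by
          rw [hinv, detScale, Real.rpow_neg (abs_nonneg _), Real.inv_rpow (abs_nonneg _)]
      _ ≤ (n.factorial * ‖glToCLM g⁻¹‖ ^ n) ^ (1 / n : ℝ) :=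
          Real.rpow_le_rpow (abs_nonneg _) hdet (by positivity)
      _ = (n.factorial : ℝ) ^ (1 / n : ℝ) * ‖glToCLM g⁻¹‖ := by
          rw [Real.mul_rpow (by positivity) (by positivity), ← Real.rpow_natCast,
            ← Real.rpow_mul (norm_nonneg _), mul_one_div_cancel hn, Real.rpow_one]
  rw [Matrix.smul_apply, smul_eq_mul, abs_mul, abs_of_pos (detScale_pos g), qcDistortion, ← mul_assoc]
  exact mul_le_mul hscale (abs_apply_le_norm_glToCLM g i j) (abs_nonneg _) (by positivity)

theorem mem_conformalLinearGroup_of_transpose_mul_self {g : GL (Fin n) ℝ} {s : ℝ} (hs : 0 < s)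
    (h : (g : Matrix (Fin n) (Fin n) ℝ)ᵀ * g = s • 1) : g ∈ conformalLinearGroup n := by
  refine (isConformalMap_iff (glToCLM g)).2 ⟨s, hs, fun u v => ?_⟩
  have h1 : star (glToCLM g) * glToCLM g = s • 1 := by
    rw [glToCLM, ← map_star, ← map_mul, star_eq_conjTranspose,
      conjTranspose_eq_transpose_of_trivial, h, map_smul, map_one]
  have h2 : ContinuousLinearMap.adjoint (glToCLM g) (glToCLM g v) = s • v :=
    congrArg (fun T : EuclideanSpace ℝ (Fin n) →L[ℝ] EuclideanSpace ℝ (Fin n) => T v) h1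
  rw [← ContinuousLinearMap.adjoint_inner_right, h2, real_inner_smul_right]

end GeneralLinear

/-! ### Invariant conformal structures -/

section Cocycle

variable {Γ X : Type*} [Semigroup Γ] [TopologicalSpace X] [SemigroupAction Γ X] {n : ℕ}
  {A : Γ → X → GL (Fin n) ℝ}

/-- The field of inner products that is invariant under the cocycle normalized to determinant `±1`
is invariant up to positive factors under the cocycle itself. -/
theorem exists_continuous_conformally_invariant_posDef [CompactSpace X] [T2Space X]
    [ContinuousConstSMul Γ X] (hmin : IsMinimalAction Γ X) (hA : IsLinearCocycle A)
    {x₀ : X} {C : ℝ} (hC : ∀ f : Γ, qcDistortion (A f x₀) ≤ C) :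
    ∃ c : X → Matrix (Fin n) (Fin n) ℝ, Continuous c ∧ (∀ x, (c x).PosDef) ∧
      ∀ f x, ∃ s : ℝ, 0 < s ∧
        (A f x : Matrix (Fin n) (Fin n) ℝ)ᵀ * c (f • x) * (A f x : Matrix _ _ ℝ) = s • c x := by
  -- for `n = 0` traces vanish, and so does the minimal radius on which the general argument rests
  rcases Nat.eq_zero_or_pos n with rfl | hn
  · exact ⟨fun _ => 1, continuous_const, fun _ => PosDef.one, fun f x =>
      ⟨1, one_pos, Subsingleton.elim _ _⟩⟩
  have : NeZero n := ⟨hn.ne'⟩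
  obtain ⟨c, hc, hpos, hinv⟩ := exists_continuous_invariant_posDef_of_bounded
    (a := fun f x => detScale (A f x) • (A f x : Matrix (Fin n) (Fin n) ℝ)) hmin
    (fun f => (continuous_detScale.comp (hA.continuous f)).smul
      (Units.continuous_val.comp (hA.continuous f)))
    (fun f g x => by
      rw [hA.map_mul, detScale_mul, Units.val_mul, smul_mul_smul_comm])
    (fun f x => det_detScale_smul_sq (A f x)) (x₀ := x₀)
    (M := (n.factorial : ℝ) ^ (1 / n : ℝ) * C)
    (fun f i j => (abs_detScale_smul_apply_le _ i j).trans (by gcongr; exact hC f))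
  refine ⟨c, hc, hpos, fun f x => ?_⟩
  have hd := detScale_pos (A f x)
  refine ⟨(detScale (A f x) * detScale (A f x))⁻¹, by positivity, ?_⟩
  rw [← hinv f x, transpose_smul, smul_mul_assoc, smul_mul_assoc, mul_smul_comm, smul_smul,
    smul_smul, mul_assoc (_)⁻¹, inv_mul_cancel₀ (by positivity), one_smul]

theorem isContinuousInvariantConformalStructure_mk {c : X → Matrix (Fin n) (Fin n) ℝ}
    (hc : Continuous c) (hpos : ∀ x, (c x).PosDef)
    (hinv : ∀ f x, ∃ s : ℝ, 0 < s ∧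
      (A f x : Matrix (Fin n) (Fin n) ℝ)ᵀ * c (f • x) * (A f x : Matrix _ _ ℝ) = s • c x) :
    IsContinuousInvariantConformalStructure A fun x =>
      (Quotient.mk (conformalSetoid n) ⟨c x, hpos x⟩ : ConformalStructure n) where
  continuous := continuous_quotient_mk'.comp (hc.subtype_mk hpos)
  invariant f x := by
    obtain ⟨s, hs, h⟩ := hinv f x
    refine Quotient.sound (s := conformalSetoid n) ⟨s, hs, ?_⟩
    have h1 : (A f x : Matrix (Fin n) (Fin n) ℝ) * ((A f x)⁻¹ : GL (Fin n) ℝ) = 1 :=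
      Units.mul_inv _
    have h2 : (((A f x)⁻¹ : GL (Fin n) ℝ) : Matrix (Fin n) (Fin n) ℝ)ᵀ *
        (A f x : Matrix (Fin n) (Fin n) ℝ)ᵀ = 1 := by rw [← transpose_mul, h1, transpose_one]
    change c (f • x) = s • (_ * c x * _)
    rw [← smul_mul_assoc, ← mul_smul_comm, ← h, mul_assoc, mul_assoc, h1, mul_one, ← mul_assoc, h2,
      one_mul]

theorem IsLinearCocycle.conj [ContinuousConstSMul Γ X] (hA : IsLinearCocycle A)
    {B : X → GL (Fin n) ℝ} (hB : Continuous B) :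
    IsLinearCocycle fun f x => (B (f • x))⁻¹ * A f x * B x where
  continuous f := by
    have := hA.continuous f
    fun_prop
  map_mul f g x := by
    rw [hA.map_mul, mul_smul]
    group

/-- A continuous invariant conformal structure turns into the standard one after the change of
frame by the inverse of its square root. -/
theorem exists_cohomologous_conformal [CompactSpace X] [ContinuousConstSMul Γ X]
    (hA : IsLinearCocycle A) {c : X → Matrix (Fin n) (Fin n) ℝ} (hc : Continuous c)
    (hpos : ∀ x, (c x).PosDef) (hinv : ∀ f x, ∃ s : ℝ, 0 < s ∧
      (A f x : Matrix (Fin n) (Fin n) ℝ)ᵀ * c (f • x) * (A f x : Matrix _ _ ℝ) = s • c x) :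
    ∃ A' : Γ → X → GL (Fin n) ℝ, IsLinearCocycle A' ∧ Cohomologous A A' ∧
      ∀ (f : Γ) (x : X), A' f x ∈ conformalLinearGroup n := by
  obtain ⟨R, hR, hsymm, hsq, hunit⟩ := exists_continuous_sqrt hc hpos
  set B : X → GL (Fin n) ℝ := fun x =>
    ⟨(R x)⁻¹, R x, nonsing_inv_mul _ (hunit x), mul_nonsing_inv _ (hunit x)⟩
  have hB : Continuous B := by
    refine Units.continuous_iff.2 ⟨?_, hR⟩
    change Continuous fun x => (R x)⁻¹
    simp only [inv_def, Ring.inverse_eq_inv']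
    exact (hR.matrix_det.inv₀ fun x => (hunit x).ne_zero).smul hR.matrix_adjugate
  refine ⟨_, hA.conj hB, ⟨B, hB, fun _ _ => rfl⟩, fun f x => ?_⟩
  obtain ⟨s, hs, h⟩ := hinv f x
  refine mem_conformalLinearGroup_of_transpose_mul_self hs ?_
  change (R (f • x) * (A f x : Matrix (Fin n) (Fin n) ℝ) * (R x)⁻¹)ᵀ *
    (R (f • x) * (A f x : Matrix (Fin n) (Fin n) ℝ) * (R x)⁻¹) = s • 1
  calc _ = ((R x)⁻¹)ᵀ * ((A f x : Matrix (Fin n) (Fin n) ℝ)ᵀ *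
        ((R (f • x))ᵀ * R (f • x)) * (A f x : Matrix (Fin n) (Fin n) ℝ)) * (R x)⁻¹ := by
        simp only [transpose_mul, mul_assoc]
    _ = s • ((R x)⁻¹ * (R x * R x) * (R x)⁻¹) := by
        rw [hsymm, hsq, h, transpose_nonsing_inv, hsymm, hsq, mul_smul_comm, smul_mul_assoc]
    _ = s • 1 := by
        rw [nonsing_inv_mul_cancel_left _ _ (hunit x), mul_nonsing_inv _ (hunit x)]

end Cocycle

theorem theoremB {Γ X : Type*} [Semigroup Γ] [MetricSpace X] [CompactSpace X]
    [SemigroupAction Γ X] [ContinuousConstSMul Γ X] (hmin : IsMinimalAction Γ X)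
    {n : ℕ} (A : Γ → X → GL (Fin n) ℝ) (hA : IsLinearCocycle A)
    (hbdd : ∃ x₀ : X, ∃ C : ℝ, 0 < C ∧ ∀ f : Γ, qcDistortion (A f x₀) ≤ C) :
    (∃ φ : X → ConformalStructure n, IsContinuousInvariantConformalStructure A φ) ∧
    (∃ A' : Γ → X → GL (Fin n) ℝ, IsLinearCocycle A' ∧ Cohomologous A A' ∧
      ∀ (f : Γ) (x : X), A' f x ∈ conformalLinearGroup n) := by
  obtain ⟨x₀, C, -, hC⟩ := hbdd
  obtain ⟨c, hc, hpos, hinv⟩ := exists_continuous_conformally_invariant_posDef hmin hA hC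
  exact ⟨⟨_, isContinuousInvariantConformalStructure_mk hc hpos hinv⟩,
    exists_cohomologous_conformal hA hc hpos hinv⟩
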